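/- Let $d\ge 3$ and $k\ge 0$ be integers, and let $T\subset\mathbb{R}^d$ be a clean $k$-point lattice $d$-simplex, that is, the convex hull of $d+1$ affinely independent points of $\mathbb{Z}^d$ (its vertices) such that the only points of $\mathbb{Z}^d$ on the boundary of $T$ are the vertices of $T$, and exactly $k$ points of $\mathbb{Z}^d$ lie in the interior of $T$. Suppose that $T$ has volume $\frac{dk+1}{d!}$. Then any two distinct interior lattice points of $T$ are collinear with some vertex of $T$. Moreover, there is a vertex $v$ of $T$ such that $v$ and all interior lattice points of $T$ lie on a single line. -/

import Mathlib

/-- The integer lattice `ℤ^d` inside `ℝ^d`. -/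
def intLattice (d : ℕ) : Set (Fin d → ℝ) :=
  {x | ∀ i, ∃ z : ℤ, x i = (z : ℝ)}

/-- The `d`-simplex in `ℝ^d` as a point set: the convex hull of its `d + 1` affinely independent
vertices. -/
def simplexBody {d : ℕ} (T : Affine.Simplex ℝ (Fin d → ℝ) d) : Set (Fin d → ℝ) :=
  convexHull ℝ (Set.range T.points)

/-- The lattice points in the interior of the simplex. -/
def interiorLatticePoints {d : ℕ} (T : Affine.Simplex ℝ (Fin d → ℝ) d) : Set (Fin d → ℝ) :=
  interior (simplexBody T) ∩ intLattice d

/-- `T` is a clean `k`-point lattice `d`-simplex: its vertices are lattice points, the only lattice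
points on its boundary are its vertices, and it has exactly `k` lattice points in its interior. -/
structure IsCleanLatticeSimplex {d : ℕ} (k : ℕ) (T : Affine.Simplex ℝ (Fin d → ℝ) d) : Prop where
  lattice : Set.range T.points ⊆ intLattice d
  clean : frontier (simplexBody T) ∩ intLattice d = Set.range T.points
  card_interior : (interiorLatticePoints T).encard = k

/-! Let `G` be `ℤ^d` modulo the lattice `L` spanned by the edges at one vertex. Its order is `d!`
times the volume, so here at most `dk + 1`. Barycentric coordinates modulo `ℤ` live on `G`, and the
interior lattice points become a set `A` of `k` classes whose representatives in `[0, 1)` are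
positive with sum `1`.

Call a class of level at most `j` if it has a positive lift of integral sum at most `j`, or is zero.
A nontrivial lift of `0` has positive integer entries, hence sum at least `d + 1`. So up to total
level `d`, `0` has only the trivial representation, and Scherk's theorem gives at least `jk + 1`
classes of level at most `j`. Taking `j = d` yields `|G| = dk + 1`: every inequality is tight.

Tightness has two effects. Nonzero classes have no zero coordinate (`coord_pos`), which prevents `A`
from containing a coset of a nontrivial cyclic subgroup. Also the classes of level at most `d - 2`
and `A ∪ {0}` form a critical pair, which is reduced by e-transforms until `A` is seen to be `{y,
2y, ..., ky}` (`eq_image_nsmul_of_critical`).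

Finally, lifts of `0` of sum exactly `d + 1` have all entries `1`. This makes the coordinate vectors
of `sy` an honest arithmetic progression, whose term at `s = 0` is a unit vector when `k ≥ 2`: the
vertex on the line (`exists_line`). -/

/-! ### Scherk's theorem and a criterion for arithmetic progressions. -/

namespace ZeroSumFree

open Finset Pointwise

variable {G : Type*} [AddCommGroup G]

/-- In a finite group the negative of an element is one of its natural multiples. -/
theorem exists_nsmul_eq_neg [Finite G] (y : G) : ∃ n : ℕ, n • y = -y := by
  refine ⟨addOrderOf y - 1, ?_⟩
  have h := addOrderOf_pos y
  have h2 := addOrderOf_nsmul_eq_zero y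
  obtain ⟨n, hn⟩ : ∃ n, addOrderOf y = n + 1 := ⟨addOrderOf y - 1, by omega⟩
  rw [hn] at h2 ⊢
  rw [succ_nsmul] at h2
  exact eq_neg_of_add_eq_zero_left h2

/-- If `X` is closed under adding `y` and contains `0`, then it contains `-y`. -/
theorem neg_mem_of_add_mem [Finite G] {X : Finset G} {y : G} (h0 : 0 ∈ X)
    (hX : ∀ x ∈ X, x + y ∈ X) : -y ∈ X := by
  obtain ⟨n, hn⟩ := exists_nsmul_eq_neg y
  rw [← hn]
  clear hn
  induction n with
  | zero => simpa using h0
  | succ n ih =>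
    rw [succ_nsmul]
    exact hX _ ih

variable [DecidableEq G]

/-- The number of elements is preserved by the `e`-transform. -/
theorem card_eTransform (X Y : Finset G) (e : G) :
    #(X ∪ Y.image (e + ·)) + #{y ∈ Y | e + y ∈ X} = #X + #Y := by
  have h1 : #(X ∩ Y.image (e + ·)) = #{y ∈ Y | e + y ∈ X} := by
    rw [← card_image_of_injective {y ∈ Y | e + y ∈ X} (add_right_injective e)]
    congr 1
    ext z
    simp only [mem_inter, mem_image, mem_filter]
    constructor
    · rintro ⟨hz, y, hy, rfl⟩
      exact ⟨y, ⟨hy, hz⟩, rfl⟩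
    · rintro ⟨y, ⟨hy, hz⟩, rfl⟩
      exact ⟨hz, y, hy, rfl⟩
  rw [← h1, card_union_add_card_inter, card_image_of_injective _ (add_right_injective e)]

/-- Scherk's theorem: if `0` has only the trivial representation in `X + Y`, then
`#X + #Y ≤ #(X + Y) + 1`. -/
theorem scherk [Finite G] (X Y : Finset G) (hX : 0 ∈ X) (hY : 0 ∈ Y)
    (h : ∀ x ∈ X, ∀ y ∈ Y, x + y = 0 → y = 0) : #X + #Y ≤ #(X + Y) + 1 := by
  induction hn : #Y using Nat.strong_induction_on generalizing X Y with
  | _ n ih =>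
  subst hn
  by_cases hY0 : ∀ y ∈ Y, y = 0
  · have hY1 : Y = {0} := by
      ext y
      simp only [mem_singleton]
      exact ⟨hY0 y, fun hy => hy ▸ hY⟩
    subst hY1
    simp
  push Not at hY0
  obtain ⟨y, hy, hy0⟩ := hY0
  -- Otherwise `X` is closed under adding `y`, so it contains `-y`, and `-y + y = 0` is a forbidden
  -- representation.
  obtain ⟨e, he, z, hz, hez⟩ : ∃ e ∈ X, ∃ z ∈ Y, e + z ∉ X := by
    by_contra! hcon
    have hmem : ∀ n : ℕ, n • y ∈ X := by
      intro n
      induction n with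
      | zero => simpa using hX
      | succ n ihn =>
        rw [succ_nsmul]
        exact hcon _ ihn _ hy
    obtain ⟨n, hn⟩ := exists_nsmul_eq_neg y
    exact hy0 (h _ (hmem n) y hy (by rw [hn]; simp))
  have hlt : #{y ∈ Y | e + y ∈ X} < #Y := by
    refine card_lt_card (filter_ssubset.2 ⟨z, hz, hez⟩)
  -- The e-transform keeps the total size, shrinks `Y`, and its sumset stays inside `X + Y`.
  have key := ih _ hlt (X ∪ Y.image (e + ·)) {y ∈ Y | e + y ∈ X} (mem_union_left _ hX)
    (by simp [hY, he]) ?_ rfl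
  · rw [card_eTransform] at key
    refine key.trans (Nat.add_le_add_right (card_le_card ?_) 1)
    intro w hw
    obtain ⟨u, hu, v, hv, rfl⟩ := mem_add.1 hw
    rw [mem_filter] at hv
    rcases mem_union.1 hu with hu | hu
    · exact add_mem_add hu hv.1
    · obtain ⟨t, ht, rfl⟩ := mem_image.1 hu
      exact mem_add.2 ⟨e + v, hv.2, t, ht, by abel⟩
  · intro u hu v hv huv
    rw [mem_filter] at hv
    rcases mem_union.1 hu with hu | hu
    · exact h u hu v hv.1 huv
    · obtain ⟨t, ht, rfl⟩ := mem_image.1 hu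
      have ht0 : t = 0 := h _ hv.2 t ht (by rw [← huv]; abel)
      subst ht0
      exact h e he v hv.1 (by simpa using huv)

/-- If `A` is moved off itself by `y` only at one place, then `A` is an arithmetic progression
with difference `y`, starting at `y`. -/
theorem eq_image_nsmul_of_step {A : Finset G} (h0 : 0 ∉ A)
    (hcos : ∀ h : G, h ≠ 0 → ∀ a ∈ A, ∃ n : ℕ, a + n • h ∉ A) {y q : G} (hy : y ∈ A)
    (hstep : ∀ a ∈ A, a + y ∈ A ∨ a + y = q) :
    ∃ m : ℕ, A = (Icc 1 m).image (· • y) := by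
  have hy0 : y ≠ 0 := fun h => h0 (h ▸ hy)
  -- Every walk by steps of `y` must leave `A`, and the only exit is `q`; comparing with the walk
  -- from `y` locates `a`.
  have exit : ∀ a ∈ A, ∃ n : ℕ, 0 < n ∧ a + n • y = q ∧ ∀ i < n, a + i • y ∈ A := by
    intro a ha
    classical
    have hex := hcos y hy0 a ha
    have hmin : ∀ i < Nat.find hex, a + i • y ∈ A := fun i hi =>
      not_not.1 (Nat.find_min hex hi)
    have hspec := Nat.find_spec hex
    obtain ⟨n, hn⟩ : ∃ n, Nat.find hex = n + 1 := by
      refine Nat.exists_eq_succ_of_ne_zero fun h => ?_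
      rw [h] at hspec
      simp [ha] at hspec
    refine ⟨Nat.find hex, by omega, ?_, hmin⟩
    rw [hn] at hspec hmin ⊢
    rw [succ_nsmul, ← add_assoc] at hspec ⊢
    exact (hstep _ (hmin n (Nat.lt_succ_self n))).resolve_left hspec
  obtain ⟨m, -, hm, hmA⟩ := exit y hy
  refine ⟨m, ?_⟩
  ext a
  simp only [mem_image, mem_Icc]
  constructor
  · intro ha
    obtain ⟨n, hn0, hn, hnA⟩ := exit a ha
    rcases le_or_gt n m with hle | hlt
    · obtain ⟨c, rfl⟩ := Nat.exists_eq_add_of_le hle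
      refine ⟨c + 1, ⟨by omega, by omega⟩, ?_⟩
      have : a + n • y = (c + 1) • y + n • y := by
        rw [hn, ← hm, ← add_nsmul, ← succ_nsmul']
        congr 1
        omega
      exact (add_right_cancel this).symm
    -- A walk longer than the one from `y` would pass through `0` before leaving `A`.
    · exfalso
      have h1 := hnA (n - (m + 1)) (by omega)
      have h2 : a + (n - (m + 1)) • y = 0 := by
        have : a + (n - (m + 1)) • y + (m + 1) • y = 0 + (m + 1) • y := by
          rw [add_assoc, ← add_nsmul, Nat.sub_add_cancel (by omega), hn, zero_add, succ_nsmul',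
            hm]
        exact add_right_cancel this
      rw [h2] at h1
      exact h0 h1
  · rintro ⟨i, ⟨hi1, him⟩, rfl⟩
    obtain ⟨j, rfl⟩ := Nat.exists_eq_add_of_le' hi1
    rw [succ_nsmul']
    exact hmA j (by omega)

end ZeroSumFree

/-! ### Critical pairs and their e-transforms. -/

namespace ZeroSumFree

open Finset Pointwise

variable {G : Type*} [AddCommGroup G] [DecidableEq G]

/-- A critical pair `(X, Y)` whose `e`-transforms are all trivial forces `A` to be an arithmetic
progression. -/
theorem eq_image_nsmul_of_terminal [Fintype G] {A X Y : Finset G} (h0 : 0 ∉ A)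
    (hcos : ∀ h : G, h ≠ 0 → ∀ a ∈ A, ∃ n : ℕ, a + n • h ∉ A)
    (hY0 : 0 ∈ Y) (hYA : Y ⊆ insert 0 A) (hYX : Y ⊆ X) (hY2 : 2 ≤ #Y)
    (hsum : ∀ x ∈ X, ∀ y ∈ Y, -(x + y) ∉ A)
    (hcard : Fintype.card G + 1 ≤ #X + #Y + #A)
    (hterm : ∀ e ∈ X, (∀ y ∈ Y, e + y ∈ X) ∨ ∀ y ∈ Y, e + y ∈ X → y = 0) :
    ∃ y m, A = (Icc 1 m).image (· • y) := by
  have hX0 : 0 ∈ X := hYX hY0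
  have hA : ∀ y ∈ Y, y ≠ 0 → y ∈ A := fun y hy hy0 =>
    (mem_insert.1 (hYA hy)).resolve_left hy0
  obtain ⟨y, hy, hy0⟩ : ∃ y ∈ Y, y ≠ 0 := exists_mem_ne (by omega) 0
  have hnotclosed : ∀ S ⊆ X, 0 ∈ S → ∀ y ∈ Y, y ≠ 0 → ¬ ∀ x ∈ S, x + y ∈ S := by
    intro S hS hS0 y hy hy0 hcl
    have := hsum _ (hS (neg_mem_of_add_mem hS0 hcl)) 0 hY0
    rw [add_zero, neg_neg] at this
    exact this (hA y hy hy0)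
  -- For such `e` the sets `X` and `e + Y` share only `e`. By `hcard`, their union together with the
  -- disjoint set `-A` exhausts `G`.
  have hfill : ∀ e ∈ X, (∀ y ∈ Y, e + y ∈ X → y = 0) →
      ∀ z, -z ∉ A → z ∈ X ∨ ∃ t ∈ Y, t ≠ 0 ∧ z = e + t := by
    intro e he hbad z hz
    have hfe : {y ∈ Y | e + y ∈ X} = {0} := by
      ext t
      simp only [mem_filter, mem_singleton]
      constructor
      · exact fun h => hbad t h.1 h.2
      · rintro rfl
        exact ⟨hY0, by simpa using he⟩
    have hc := card_eTransform X Y e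
    rw [hfe, card_singleton] at hc
    have hdisj : Disjoint (X ∪ Y.image (e + ·)) (A.image (- ·)) := by
      rw [disjoint_left]
      intro w hw hw'
      obtain ⟨a, ha, rfl⟩ := mem_image.1 hw'
      rcases mem_union.1 hw with hw | hw
      · exact hsum _ hw 0 hY0 (by simpa using ha)
      · obtain ⟨t, ht, hte⟩ := mem_image.1 hw
        refine hsum e he t ht ?_
        have : e + t = -a := hte
        rw [this, neg_neg]
        exact ha
    have huniv : (X ∪ Y.image (e + ·)) ∪ A.image (- ·) = univ := by
      rw [← card_eq_iff_eq_univ]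
      refine le_antisymm (card_le_univ _) ?_
      rw [card_union_of_disjoint hdisj, card_image_of_injective _ neg_injective]
      omega
    have hzm : z ∈ (X ∪ Y.image (e + ·)) ∪ A.image (- ·) := huniv ▸ mem_univ z
    rcases mem_union.1 hzm with h | h
    · rcases mem_union.1 h with h | h
      · exact Or.inl h
      · obtain ⟨t, ht, rfl⟩ := mem_image.1 h
        by_cases ht0 : t = 0
        · left
          simpa [ht0] using he
        · exact Or.inr ⟨t, ht, ht0, rfl⟩
    · obtain ⟨a, ha, rfl⟩ := mem_image.1 h
      exact absurd ha (by simpa using hz)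
  obtain ⟨e, he, hbad⟩ : ∃ e ∈ X, ∀ y ∈ Y, e + y ∈ X → y = 0 := by
    by_contra! hcon
    refine hnotclosed X subset_rfl hX0 y hy hy0 fun x hx => ?_
    obtain ⟨t, ht, htX, ht0⟩ := hcon x hx
    exact (hterm x hx).resolve_right (fun h => ht0 (h t ht htX)) y hy
  by_cases huniq : ∀ t ∈ Y, t ≠ 0 → t = y
  -- If `a + y` leaves `A`, then `-(a + y)` is not in `X`, since adding `y` would give `-a`. By
  -- `hfill` it is `e + y`, the same point for every `a`.
  · refine ⟨y, eq_image_nsmul_of_step h0 hcos (hA y hy hy0) (q := -(e + y)) fun a ha => ?_⟩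
    by_contra! hcon
    rcases hfill e he hbad (-(a + y)) (by simpa using hcon.1) with h | ⟨t, ht, ht0, hte⟩
    · exact hsum _ h y hy (by simpa using ha)
    · rw [huniq t ht ht0] at hte
      exact hcon.2 (by rw [← hte, neg_neg])
  exfalso
  push Not at huniq
  obtain ⟨y', hy', hy'0, hyy'⟩ := huniq
  -- With a second bad element `x`, filling from `x` gives `e + t = x + s`, so `Y \ {0}` would be
  -- stable under adding `e - x`, against `hcos`.
  have hgood : ∀ x ∈ X, x ≠ e → ∀ t ∈ Y, x + t ∈ X := by
    intro x hx hxe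
    refine (hterm x hx).resolve_right fun hxbad => ?_
    obtain ⟨n, hn⟩ := hcos (e - x) (sub_ne_zero.2 (Ne.symm hxe)) y (hA y hy hy0)
    suffices ∀ n : ℕ, y + n • (e - x) ∈ Y ∧ y + n • (e - x) ≠ 0 from
      hn (hA _ (this n).1 (this n).2)
    intro n
    induction n with
    | zero => simpa using ⟨hy, hy0⟩
    | succ n ih =>
      set t := y + n • (e - x) with ht
      have ht' : y + (n + 1) • (e - x) = t + (e - x) := by rw [ht, succ_nsmul, add_assoc]
      rw [ht']
      rcases hfill x hx hxbad (e + t) (hsum e he t ih.1) with h | ⟨s, hs, hs0, hse⟩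
      · exact absurd (hbad t ih.1 h) ih.2
      · have : t + (e - x) = s := by
          rw [← add_sub_assoc, add_comm t e, hse, add_sub_cancel_left]
        rw [this]
        exact ⟨hs, hs0⟩
  -- Otherwise `e - y`, then `e - y + y'`, are good, and `e + y'` lies in `X` although `e` is bad.
  -- Hence `X \ {e}` is closed under adding `y`.
  have hney : e - y ∉ X := by
    intro h
    have h1 : e - y + y' ∈ X := hgood _ h (by simpa using hy0) y' hy'
    have h2 : e - y + y' + y ∈ X :=
      hgood _ h1 (fun h => hyy' (by simpa using eq_sub_of_add_eq' h)) y hy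
    refine hy'0 (hbad y' hy' ?_)
    convert h2 using 1
    abel
  have he0 : e ≠ 0 := by
    rintro rfl
    exact hy0 (hbad y hy (by simpa using hYX hy))
  refine hnotclosed (X.erase e) (erase_subset _ _) (mem_erase.2 ⟨he0.symm, hX0⟩) y hy hy0 ?_
  intro x hx
  obtain ⟨hxe, hxX⟩ := mem_erase.1 hx
  refine mem_erase.2 ⟨fun h => hney ?_, hgood x hxX hxe y hy⟩
  rwa [← eq_sub_of_add_eq h]

/-- A set `A` such that `-A` is the complement of `X + (A ∪ {0})`, where the pair of summands is
critical, is an arithmetic progression unless it contains a full coset. -/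
theorem eq_image_nsmul_of_critical [Fintype G] {A X Y : Finset G} (h0 : 0 ∉ A)
    (hcos : ∀ h : G, h ≠ 0 → ∀ a ∈ A, ∃ n : ℕ, a + n • h ∉ A)
    (hY0 : 0 ∈ Y) (hYA : Y ⊆ insert 0 A) (hYX : Y ⊆ X) (hY2 : 2 ≤ #Y)
    (hsum : ∀ x ∈ X, ∀ y ∈ Y, -(x + y) ∉ A)
    (hcard : Fintype.card G + 1 ≤ #X + #Y + #A) :
    ∃ y m, A = (Icc 1 m).image (· • y) := by
  induction hn : #Y using Nat.strong_induction_on generalizing X Y with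
  | _ n ih =>
  subst hn
  by_cases hterm : ∀ e ∈ X, (∀ y ∈ Y, e + y ∈ X) ∨ ∀ y ∈ Y, e + y ∈ X → y = 0
  · exact eq_image_nsmul_of_terminal h0 hcos hY0 hYA hYX hY2 hsum hcard hterm
  push Not at hterm
  obtain ⟨e, he, ⟨z, hz, hez⟩, t, ht, het, ht0⟩ := hterm
  have hsub : {y ∈ Y | e + y ∈ X} ⊆ Y := filter_subset _ _
  have hmem0 : 0 ∈ {y ∈ Y | e + y ∈ X} := mem_filter.2 ⟨hY0, by simpa using he⟩
  refine ih _ (card_lt_card (filter_ssubset.2 ⟨z, hz, hez⟩)) (X := X ∪ Y.image (e + ·))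
    hmem0 (hsub.trans hYA) (hsub.trans (hYX.trans subset_union_left)) ?_ ?_ ?_ rfl
  · exact one_lt_card.2 ⟨0, hmem0, t, mem_filter.2 ⟨ht, het⟩, ht0.symm⟩
  · intro u hu v hv
    rw [mem_filter] at hv
    rcases mem_union.1 hu with hu | hu
    · exact hsum u hu v hv.1
    · obtain ⟨s, hs, rfl⟩ := mem_image.1 hu
      rw [add_right_comm]
      exact hsum _ hv.2 s hs
  · rw [card_eTransform]
    exact hcard

end ZeroSumFree

/-! ### Fractional coordinates and their positive lifts. -/

/-- Coordinates on an abelian group with values in `[0, 1)` that are additive modulo `ℤ` and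
vanish simultaneously only at `0`. -/
structure FracCoords (G ι : Type*) [AddCommGroup G] where
  coord : G → ι → ℝ
  nonneg : ∀ g i, 0 ≤ coord g i
  lt_one : ∀ g i, coord g i < 1
  add : ∀ g h i, ∃ z : ℤ, coord (g + h) i = coord g i + coord h i + z
  eq_zero : ∀ g, (∀ i, coord g i = 0) → g = 0

namespace FracCoords

open Finset

variable {G ι : Type*} [AddCommGroup G] (c : FracCoords G ι)

theorem coord_zero (i : ι) : c.coord 0 i = 0 := by
  obtain ⟨z, hz⟩ := c.add 0 0 i
  rw [add_zero] at hz
  have h0 := c.nonneg 0 i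
  have h1 := c.lt_one 0 i
  have h2 : c.coord 0 i = ((-z : ℤ) : ℝ) := by push_cast; linarith
  rw [h2] at h0 h1 ⊢
  have h3 : (0 : ℤ) ≤ -z := by exact_mod_cast h0
  have h4 : -z < (1 : ℤ) := by exact_mod_cast h1
  have h5 : -z = 0 := by omega
  rw [h5, Int.cast_zero]

theorem one_le_add_neg {g : G} {i : ι} (hg : 0 < c.coord g i) :
    1 ≤ c.coord g i + c.coord (-g) i := by
  obtain ⟨z, hz⟩ := c.add g (-g) i
  rw [add_neg_cancel, coord_zero] at hz
  have h0 := c.nonneg (-g) i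
  have h1 : c.coord g i + c.coord (-g) i = ((-z : ℤ) : ℝ) := by push_cast; linarith
  have h2 : (0 : ℝ) < ((-z : ℤ) : ℝ) := by rw [← h1]; linarith
  rw [h1]
  exact_mod_cast h2

/-- The integer carry exceeds `-1`, because `coord h i < 1`; so it is nonnegative. -/
theorem add_le_coord_add {g h : G} {i : ι} (hle : c.coord g i ≤ c.coord (g + h) i) :
    c.coord g i + c.coord h i ≤ c.coord (g + h) i := by
  obtain ⟨z, hz⟩ := c.add g h i
  have h1 := c.lt_one h i
  have h2 : ((-1 : ℤ) : ℝ) < z := by push_cast; linarith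
  have h3 : (-1 : ℤ) < z := by exact_mod_cast h2
  have h4 : (0 : ℝ) ≤ z := by exact_mod_cast (by omega : (0 : ℤ) ≤ z)
  linarith

theorem zero_notMem {c : FracCoords G ι} [Nonempty ι] {A : Finset G} (hpos : ∀ a ∈ A, ∀ i, 0 < c.coord a i) :
    0 ∉ A := by
  intro h
  obtain ⟨i⟩ := ‹Nonempty ι›
  exact (hpos 0 h i).ne' (c.coord_zero i)

variable [Fintype ι]

/-- `R` is congruent modulo `ℤ` to the coordinates of `g`, its entries sum to `m` and they are
positive, or `m = 0` and both `g` and `R` vanish. -/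
structure IsLift (m : ℕ) (g : G) (R : ι → ℝ) : Prop where
  congr : ∀ i, ∃ z : ℤ, R i = c.coord g i + z
  sum : ∑ i, R i = m
  pos : m ≠ 0 → ∀ i, 0 < R i
  zero : m = 0 → g = 0 ∧ R = 0

variable {c}

theorem IsLift.nonneg {m : ℕ} {g : G} {R : ι → ℝ} (h : c.IsLift m g R) (i : ι) : 0 ≤ R i := by
  by_cases hm : m = 0
  · rw [(h.zero hm).2]
    rfl
  · exact (h.pos hm i).le

theorem isLift_zero : c.IsLift 0 0 0 :=
  ⟨fun i => ⟨0, by simp [coord_zero]⟩, by simp, by simp, by simp⟩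

theorem isLift_coord {g : G} (hpos : ∀ i, 0 < c.coord g i) (hsum : ∑ i, c.coord g i = 1) :
    c.IsLift 1 g (c.coord g) :=
  ⟨fun i => ⟨0, by simp⟩, by simpa using hsum, fun _ => hpos, by simp⟩

theorem IsLift.add {m n : ℕ} {g h : G} {R S : ι → ℝ} (hR : c.IsLift m g R)
    (hS : c.IsLift n h S) : c.IsLift (m + n) (g + h) (R + S) := by
  refine ⟨fun i => ?_, ?_, fun hmn i => ?_, fun hmn => ?_⟩
  · obtain ⟨z, hz⟩ := hR.congr i
    obtain ⟨w, hw⟩ := hS.congr i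
    obtain ⟨t, ht⟩ := c.add g h i
    refine ⟨z + w - t, ?_⟩
    rw [Pi.add_apply, hz, hw, ht]
    push_cast
    ring
  · simp [Finset.sum_add_distrib, hR.sum, hS.sum]
  · by_cases hm : m = 0
    · exact add_pos_of_nonneg_of_pos (hR.nonneg i) (hS.pos (by omega) i)
    · exact add_pos_of_pos_of_nonneg (hR.pos hm i) (hS.nonneg i)
  · obtain ⟨h1, h2⟩ := hR.zero (by omega)
    obtain ⟨h3, h4⟩ := hS.zero (by omega)
    simp [h1, h2, h3, h4]

theorem IsLift.nsmul {m : ℕ} {g : G} {R : ι → ℝ} (hR : c.IsLift m g R) (n : ℕ) :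
    c.IsLift (n * m) (n • g) (n • R) := by
  induction n with
  | zero => simpa using isLift_zero
  | succ n ih =>
    rw [succ_nsmul, succ_nsmul, add_mul, one_mul]
    exact ih.add hR

theorem IsLift.one_le {m : ℕ} {R : ι → ℝ} (h : c.IsLift m 0 R) (hm : m ≠ 0) (i : ι) :
    1 ≤ R i := by
  obtain ⟨z, hz⟩ := h.congr i
  have h0 := h.pos hm i
  rw [coord_zero, zero_add] at hz
  rw [hz] at h0 ⊢
  exact_mod_cast h0

theorem IsLift.card_le {m : ℕ} {R : ι → ℝ} (h : c.IsLift m 0 R) (hm : m ≠ 0) :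
    Fintype.card ι ≤ m := by
  have : ∑ _i : ι, (1 : ℝ) ≤ ∑ i, R i := Finset.sum_le_sum fun i _ => h.one_le hm i
  rw [h.sum] at this
  simpa using this

theorem IsLift.eq_one {m : ℕ} {R : ι → ℝ} (h : c.IsLift m 0 R) (hm : m ≠ 0)
    (hcard : m ≤ Fintype.card ι) (i : ι) : R i = 1 := by
  have h1 : ∑ _i : ι, (1 : ℝ) = ∑ i, R i := by
    rw [h.sum, le_antisymm hcard (h.card_le hm)]
    simp
  exact ((Finset.sum_eq_sum_iff_of_le fun i _ => h.one_le hm i).1 h1 i (Finset.mem_univ i)).symm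

/-- A coset of a nontrivial cyclic subgroup contains an element whose coordinates are not
positive with sum `1`, if the coordinates of nonzero elements do not vanish. -/
theorem exists_add_nsmul_notMem [Finite G] (hι : 4 ≤ Fintype.card ι)
    (hfull : ∀ g : G, g ≠ 0 → ∀ i, 0 < c.coord g i) {A : Finset G}
    (hpos : ∀ a ∈ A, ∀ i, 0 < c.coord a i) (hsum : ∀ a ∈ A, ∑ i, c.coord a i = 1)
    (h : G) (hh : h ≠ 0) (a : G) : ∃ n : ℕ, a + n • h ∉ A := by
  by_contra! hcon
  classical
  set H := AddSubgroup.zmultiples h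
  have : Fintype H := Fintype.ofFinite H
  have hmem : ∀ ζ : H, a + ζ ∈ A := by
    rintro ⟨ζ, hζ⟩
    obtain ⟨n, rfl⟩ := (mem_multiples_iff_mem_zmultiples).2 hζ
    exact hcon n
  have hcard : (2 : ℝ) ≤ Fintype.card H := by
    have : 1 < Fintype.card H := Fintype.one_lt_card_iff.2
      ⟨0, ⟨h, AddSubgroup.mem_zmultiples h⟩, fun heq => hh (congrArg Subtype.val heq).symm⟩
    exact_mod_cast this
  -- Start the coset at its minimal `i`-th coordinate: no later term wraps around. Pairing `ζ` with
  -- `-ζ` bounds the sum over `H`. With at least four coordinates the total exceeds `2(|H| - 1) ≥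
  -- |H|`.
  have hbound : ∀ i, ((Fintype.card H : ℝ) - 1) / 2 < ∑ ζ : H, c.coord (a + ζ) i := by
    intro i
    obtain ⟨ζ₀, -, hmin⟩ := Finset.exists_min_image Finset.univ
      (fun ζ : H => c.coord (a + ζ) i) ⟨0, Finset.mem_univ _⟩
    have hshift : ∑ ζ : H, c.coord (a + ζ) i = ∑ ζ : H, c.coord (a + ζ₀ + ζ) i := by
      rw [← Equiv.sum_comp (Equiv.addLeft ζ₀)]
      simp [add_assoc]
    have h1 : ∑ ζ : H, (c.coord (a + ζ₀) i + c.coord ζ i) ≤ ∑ ζ : H, c.coord (a + ζ₀ + ζ) i := by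
      refine Finset.sum_le_sum fun ζ _ => c.add_le_coord_add ?_
      have := hmin (ζ₀ + ζ) (Finset.mem_univ _)
      simpa [add_assoc] using this
    have h2 : ∑ ζ : H, ((1 : ℝ) - if ζ = 0 then 1 else 0) ≤
        ∑ ζ : H, (c.coord ζ i + c.coord (-ζ : H) i) := by
      refine Finset.sum_le_sum fun ζ _ => ?_
      by_cases hζ : ζ = 0
      · simp [hζ, coord_zero]
      · have := c.one_le_add_neg (hfull ζ (by simpa using hζ) i)
        simpa [hζ] using this
    have h3 : ∑ ζ : H, c.coord (-ζ : H) i = ∑ ζ : H, c.coord ζ i :=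
      Equiv.sum_comp (Equiv.neg H) (fun ζ : H => c.coord ζ i)
    have h4 := hpos _ (hmem ζ₀) i
    rw [Finset.sum_add_distrib, h3, Finset.sum_sub_distrib] at h2
    rw [Finset.sum_add_distrib] at h1
    simp only [Finset.sum_const, Finset.card_univ, nsmul_eq_mul, mul_one,
      Finset.sum_ite_eq', Finset.mem_univ, if_true] at h1 h2
    rw [hshift]
    have h5 : 0 < (Fintype.card H : ℝ) * c.coord (a + ζ₀) i := by positivity
    linarith
  have hne : (Finset.univ : Finset ι).Nonempty := by
    rw [← Finset.card_pos, Finset.card_univ]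
    omega
  have htot := Finset.sum_lt_sum_of_nonempty hne fun i _ => hbound i
  rw [Finset.sum_comm, Finset.sum_congr rfl fun ζ _ => hsum _ (hmem ζ)] at htot
  simp only [Finset.sum_const, Finset.card_univ, nsmul_eq_mul, mul_one] at htot
  have : (4 : ℝ) ≤ Fintype.card ι := by exact_mod_cast hι
  nlinarith

end FracCoords

/-! ### Counting classes by level, and the case of equality. -/

namespace FracCoords

open Finset Pointwise

variable {G ι : Type*} [AddCommGroup G] [Fintype ι]

open Classical in
/-- The elements of the group that have a lift with sum at most `j`. -/
noncomputable def lowElements [Fintype G] (c : FracCoords G ι) (j : ℕ) : Finset G :=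
  {g | ∃ m ≤ j, ∃ R, c.IsLift m g R}

variable {c : FracCoords G ι} [Fintype G]

theorem mem_lowElements {j : ℕ} {g : G} :
    g ∈ c.lowElements j ↔ ∃ m ≤ j, ∃ R, c.IsLift m g R := by
  simp [lowElements]

theorem zero_mem_lowElements (j : ℕ) : 0 ∈ c.lowElements j :=
  mem_lowElements.2 ⟨0, Nat.zero_le j, 0, isLift_zero⟩

theorem add_mem_lowElements {i j : ℕ} {g h : G} (hg : g ∈ c.lowElements i)
    (hh : h ∈ c.lowElements j) : g + h ∈ c.lowElements (i + j) := by
  obtain ⟨m, hm, R, hR⟩ := mem_lowElements.1 hg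
  obtain ⟨n, hn, S, hS⟩ := mem_lowElements.1 hh
  exact mem_lowElements.2 ⟨m + n, Nat.add_le_add hm hn, R + S, hR.add hS⟩

/-- The two lifts add up to a lift of `0` whose sum is too small to be nonzero. -/
theorem eq_zero_of_add_eq_zero {i j : ℕ} {g h : G} (hij : i + j < Fintype.card ι)
    (hg : g ∈ c.lowElements i) (hh : h ∈ c.lowElements j) (hgh : g + h = 0) : h = 0 := by
  obtain ⟨m, hm, R, hR⟩ := mem_lowElements.1 hg
  obtain ⟨n, hn, S, hS⟩ := mem_lowElements.1 hh
  have hRS := hR.add hS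
  rw [hgh] at hRS
  by_contra hne
  have hn0 : n ≠ 0 := fun h0 => hne (hS.zero h0).1
  have := hRS.card_le (by omega)
  omega

theorem mem_lowElements_one {A : Finset G} (hpos : ∀ a ∈ A, ∀ i, 0 < c.coord a i)
    (hsum : ∀ a ∈ A, ∑ i, c.coord a i = 1) {a : G} (ha : a ∈ A) : a ∈ c.lowElements 1 :=
  mem_lowElements.2 ⟨1, le_rfl, _, isLift_coord (hpos a ha) (hsum a ha)⟩

/-- Adding `A ∪ {0}` raises the level by one and, by Scherk's theorem, gains at least `#A` elements.
-/
theorem card_lowElements [Nonempty ι] {A : Finset G} (hpos : ∀ a ∈ A, ∀ i, 0 < c.coord a i)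
    (hsum : ∀ a ∈ A, ∑ i, c.coord a i = 1) {j : ℕ} (hj : j < Fintype.card ι) :
    j * #A + 1 ≤ #(c.lowElements j) := by
  classical
  induction j with
  | zero =>
    simpa using card_pos.2 ⟨0, zero_mem_lowElements (c := c) 0⟩
  | succ j ih =>
    have hB : insert 0 A ⊆ c.lowElements 1 := by
      intro a ha
      rcases mem_insert.1 ha with rfl | ha
      · exact zero_mem_lowElements 1
      · exact mem_lowElements_one hpos hsum ha
    have h1 := ZeroSumFree.scherk (c.lowElements j) (insert 0 A) (zero_mem_lowElements j)
      (mem_insert_self 0 A) fun x hx y hy hxy => eq_zero_of_add_eq_zero hj hx (hB hy) hxy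
    rw [card_insert_of_notMem (zero_notMem hpos)] at h1
    have h2 : #(c.lowElements j + insert 0 A) ≤ #(c.lowElements (j + 1)) := by
      refine card_le_card fun z hz => ?_
      obtain ⟨x, hx, y, hy, rfl⟩ := mem_add.1 hz
      exact add_mem_lowElements hx (hB hy)
    have h3 := ih (by omega)
    rw [add_mul, one_mul]
    omega

/-- If the group is as small as possible, the coordinates of nonzero elements do not vanish. -/
theorem coord_pos {A : Finset G} {d : ℕ} (hι : Fintype.card ι = d + 1)
    (hpos : ∀ a ∈ A, ∀ i, 0 < c.coord a i) (hsum : ∀ a ∈ A, ∑ i, c.coord a i = 1)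
    (hG : Fintype.card G ≤ d * #A + 1) {g : G} (hg : g ≠ 0) (i : ι) : 0 < c.coord g i := by
  classical
  have : Nonempty ι := ⟨i⟩
  have hd : c.lowElements d = univ := by
    rw [← card_eq_iff_eq_univ]
    exact le_antisymm (card_le_univ _) (hG.trans (card_lowElements hpos hsum (by omega)))
  have hex : ∃ j, g ∈ c.lowElements j := ⟨d, hd ▸ mem_univ g⟩
  have hjd : Nat.find hex ≤ d := Nat.find_min' hex (hd ▸ mem_univ g)
  have hspec := Nat.find_spec hex
  have hmin : ∀ j < Nat.find hex, g ∉ c.lowElements j := fun j hj => Nat.find_min hex hj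
  set j := Nat.find hex with hj
  obtain ⟨m, hm, R, hR⟩ := mem_lowElements.1 hspec
  have hm0 : m ≠ 0 := fun h0 => hg (hR.zero h0).1
  -- Otherwise the levels up to `j - 1` and the negatives of those up to `d + 1 - j` both miss `g`,
  -- yet they meet only in `0` and are too large to fit. The resulting lifts of `g` and `-g` add up
  -- to the all-ones vector.
  have hneg : -g ∈ c.lowElements (d + 1 - j) := by
    by_contra hcon
    have hinter : c.lowElements (j - 1) ∩ (c.lowElements (d + 1 - j)).image (- ·) ⊆ {0} := by
      intro x hx
      obtain ⟨hx1, hx2⟩ := mem_inter.1 hx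
      obtain ⟨y, hy, rfl⟩ := mem_image.1 hx2
      have : y = 0 := eq_zero_of_add_eq_zero (by omega) hx1 hy (neg_add_cancel y)
      simp [this]
    have hunion : c.lowElements (j - 1) ∪ (c.lowElements (d + 1 - j)).image (- ·) ⊆
        univ.erase g := by
      intro x hx
      refine mem_erase.2 ⟨?_, mem_univ x⟩
      rintro rfl
      rcases mem_union.1 hx with hx | hx
      · exact hmin (j - 1) (by omega) hx
      · obtain ⟨y, hy, rfl⟩ := mem_image.1 hx
        exact hcon (by simpa using hy)
    have h1 := card_le_card hinter
    have h2 := card_le_card hunion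
    have h3 := card_union_add_card_inter (c.lowElements (j - 1))
      ((c.lowElements (d + 1 - j)).image (- ·))
    rw [card_image_of_injective _ neg_injective] at h3
    rw [card_erase_of_mem (mem_univ g), card_univ] at h2
    rw [card_singleton] at h1
    have h4 : (j - 1) * #A + 1 ≤ _ := card_lowElements (c := c) hpos hsum (by omega)
    have h5 : (d + 1 - j) * #A + 1 ≤ _ := card_lowElements (c := c) hpos hsum (by omega)
    have h6 : (j - 1) * #A + (d + 1 - j) * #A = d * #A := by
      rw [← add_mul]
      congr 1
      omega
    omega
  obtain ⟨m', hm', R', hR'⟩ := mem_lowElements.1 hneg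
  have hm'0 : m' ≠ 0 := fun h0 => hg (neg_eq_zero.1 (hR'.zero h0).1)
  have hRR := hR.add hR'
  rw [add_neg_cancel] at hRR
  have h1 := hRR.eq_one (by omega) (by omega) i
  rw [Pi.add_apply] at h1
  have h2 := hR.pos hm0 i
  have h3 := hR'.pos hm'0 i
  refine lt_of_le_of_ne (c.nonneg g i) fun h0 => ?_
  obtain ⟨z, hz⟩ := hR.congr i
  rw [← h0, zero_add] at hz
  rw [hz] at h1 h2
  have h4 : (z : ℝ) < 1 := by linarith
  have h5 : (0 : ℤ) < z := by exact_mod_cast h2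
  have h6 : z < 1 := by exact_mod_cast h4
  omega

/-- If the group is as small as possible, the elements of `A` form an arithmetic progression. -/
theorem exists_eq_image_nsmul [DecidableEq G] {A : Finset G} {d : ℕ} (hd : 3 ≤ d)
    (hι : Fintype.card ι = d + 1)
    (hpos : ∀ a ∈ A, ∀ i, 0 < c.coord a i) (hsum : ∀ a ∈ A, ∑ i, c.coord a i = 1)
    (hG : Fintype.card G ≤ d * #A + 1) (hne : A.Nonempty) :
    ∃ y m, A = (Icc 1 m).image (· • y) := by
  have : Nonempty ι := Fintype.card_pos_iff.1 (by omega)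
  have h0 := zero_notMem (c := c) hpos
  have hB : insert 0 A ⊆ c.lowElements 1 := by
    intro a ha
    rcases mem_insert.1 ha with rfl | ha
    · exact zero_mem_lowElements 1
    · exact mem_lowElements_one hpos hsum ha
  have hmono : c.lowElements 1 ⊆ c.lowElements (d - 2) := by
    intro g hg
    obtain ⟨m, hm, R, hR⟩ := mem_lowElements.1 hg
    exact mem_lowElements.2 ⟨m, by omega, R, hR⟩
  have hcardA := card_pos.2 hne
  -- The levels `d - 2`, `1`, `1` sum to `d`, just below the first nontrivial lift of `0`; `d ≥ 3`
  -- puts `A ∪ {0}` inside the first summand.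
  refine ZeroSumFree.eq_image_nsmul_of_critical (X := c.lowElements (d - 2)) (Y := insert 0 A) h0
    (fun h hh a _ => exists_add_nsmul_notMem (by omega) (fun g hg i => coord_pos hι hpos hsum hG hg i)
      hpos hsum h hh a)
    (mem_insert_self 0 A) subset_rfl (hB.trans hmono) ?_ ?_ ?_
  · rw [card_insert_of_notMem h0]
    omega
  · intro x hx y hy hxy
    have h1 := eq_zero_of_add_eq_zero (by omega) (add_mem_lowElements hx (hB hy))
      (mem_lowElements_one hpos hsum hxy) (add_neg_cancel _)
    exact h0 (h1 ▸ hxy)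
  · have h1 : (d - 2) * #A + 1 ≤ #(c.lowElements (d - 2)) :=
      card_lowElements hpos hsum (by omega)
    rw [card_insert_of_notMem h0]
    have h2 : (d - 2) * #A + 2 * #A = d * #A := by
      rw [← add_mul, Nat.sub_add_cancel (by omega)]
    omega

/-- If the group is as small as possible, the coordinate vectors of `A` lie on a line through a
unit vector. -/
theorem exists_line [DecidableEq ι] {A : Finset G} {d : ℕ} (hd : 3 ≤ d)
    (hι : Fintype.card ι = d + 1)
    (hpos : ∀ a ∈ A, ∀ i, 0 < c.coord a i) (hsum : ∀ a ∈ A, ∑ i, c.coord a i = 1)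
    (hG : Fintype.card G ≤ d * #A + 1) :
    ∃ (b : ι) (u : ι → ℝ), ∀ a ∈ A, ∃ s : ℝ, c.coord a = Pi.single b 1 + s • u := by
  classical
  have : Nonempty ι := Fintype.card_pos_iff.1 (by omega)
  rcases A.eq_empty_or_nonempty with rfl | hne
  · exact ⟨Classical.arbitrary ι, 0, by simp⟩
  have h0 := zero_notMem (c := c) hpos
  have hcardG : Fintype.card G = d * #A + 1 :=
    le_antisymm hG ((card_lowElements (c := c) hpos hsum (by omega)).trans (card_le_univ _))
  obtain ⟨y, k, hA⟩ := exists_eq_image_nsmul hd hι hpos hsum hG hne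
  have hmem : ∀ s, 1 ≤ s → s ≤ k → s • y ∈ A := fun s h1 h2 => by
    rw [hA]
    exact mem_image_of_mem _ (mem_Icc.2 ⟨h1, h2⟩)
  have hk : #A = k := by
    rw [hA, card_image_of_injOn, Nat.card_Icc, Nat.add_sub_cancel]
    have key : ∀ s t : ℕ, 1 ≤ s → s < t → t ≤ k → s • y ≠ t • y := by
      intro s t hs hst ht heq
      refine h0 ?_
      have : (t - s) • y = 0 := by
        have h : (t - s) • y + s • y = 0 + s • y := by
          rw [← add_nsmul, Nat.sub_add_cancel hst.le, zero_add, heq]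
        exact add_right_cancel h
      rw [← this]
      exact hmem _ (by omega) (by omega)
    intro s hs t ht heq
    obtain ⟨hs1, hs2⟩ := mem_Icc.1 (mem_coe.1 hs)
    obtain ⟨ht1, ht2⟩ := mem_Icc.1 (mem_coe.1 ht)
    rcases lt_trichotomy s t with h | h | h
    · exact absurd heq (key s t hs1 h ht2)
    · exact h
    · exact absurd heq.symm (key t s ht1 h hs2)
  have hk1 : 1 ≤ k := hk ▸ card_pos.2 hne
  rw [hk] at hcardG
  set f : ℕ → ι → ℝ := fun s => c.coord (s • y) with hf
  have hlift : ∀ s, 1 ≤ s → s ≤ k → c.IsLift 1 (s • y) (f s) := fun s h1 h2 =>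
    isLift_coord (hpos _ (hmem s h1 h2)) (hsum _ (hmem s h1 h2))
  suffices h : ∃ (b : ι) (u : ι → ℝ), ∀ s, 1 ≤ s → s ≤ k → ∃ r : ℝ, f s = Pi.single b 1 + r • u by
    obtain ⟨b, u, h⟩ := h
    refine ⟨b, u, fun a ha => ?_⟩
    rw [hA] at ha
    obtain ⟨s, hs, rfl⟩ := mem_image.1 ha
    exact h s (mem_Icc.1 hs).1 (mem_Icc.1 hs).2
  rcases hk1.eq_or_lt with hk1 | hk2
  · refine ⟨Classical.arbitrary ι, f 1 - Pi.single (Classical.arbitrary ι) 1,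
      fun s h1 h2 => ⟨1, ?_⟩⟩
    have : s = 1 := by omega
    simp [this]
  -- Since `(d - 2)k + (2k + 1) = |G|`, this is a lift of `0` with sum `d + 1`.
  have hconst : ∀ s t u, 1 ≤ s → s ≤ k → 1 ≤ t → t ≤ k → 1 ≤ u → u ≤ k → s + t + u = 2 * k + 1 →
      ∀ i, (d - 2 : ℕ) * f k i + (f s i + f t i + f u i) = 1 := by
    intro s t u hs1 hs2 ht1 ht2 hu1 hu2 hstu i
    have h := ((hlift k (by omega) le_rfl).nsmul (d - 2)).add
      (((hlift s hs1 hs2).add (hlift t ht1 ht2)).add (hlift u hu1 hu2))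
    have hz : (d - 2) • k • y + (s • y + t • y + u • y) = 0 := by
      have hN : (d - 2) * k + (s + t + u) = Fintype.card G := by
        obtain ⟨e, rfl⟩ := Nat.exists_eq_add_of_le' hd
        rw [hcardG, hstu, show e + 3 - 2 = e + 1 by omega]
        ring
      rw [← mul_nsmul', ← add_nsmul, ← add_nsmul, ← add_nsmul, hN, card_nsmul_eq_zero]
    rw [hz] at h
    have := h.eq_one (by omega) (by omega) i
    simpa using this
  -- Compare the triples `(s, k - 1, k + 2 - s)` and `(s - 1, k, k + 2 - s)`.
  have hstep : ∀ s, 2 ≤ s → s ≤ k → ∀ i, f s i = f (s - 1) i + (f k i - f (k - 1) i) := by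
    intro s hs1 hs2 i
    have h1 := hconst s (k - 1) (k + 2 - s) (by omega) hs2 (by omega) (by omega) (by omega)
      (by omega) (by omega) i
    have h2 := hconst (s - 1) k (k + 2 - s) (by omega) (by omega) (by omega) (by omega) (by omega)
      (by omega) (by omega) i
    linarith
  have hlin : ∀ s, s + 1 ≤ k → ∀ i, f (s + 1) i = f 1 i + s * (f 2 i - f 1 i) := by
    intro s
    induction s with
    | zero => simp
    | succ s ih =>
      intro hs i
      have h1 := hstep (s + 1 + 1) (by omega) hs i
      have h2 := hstep 2 le_rfl hk2 i
      have h3 := ih (by omega) i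
      simp only [Nat.add_sub_cancel, show 2 - 1 = 1 from rfl] at h1 h2
      push_cast
      rw [h1, h3]
      linarith
  -- The carry in `y + y` is an integer vector with entries above `-1` and sum `1`, hence a unit
  -- vector; it is the term at `s = 0`.
  have hz : ∀ i, ∃ z : ℤ, f 1 i + f 1 i - f 2 i = z ∧ 0 ≤ z := by
    intro i
    obtain ⟨z, hz⟩ := c.add y y i
    refine ⟨-z, ?_, ?_⟩
    · simp only [hf, one_nsmul, two_nsmul]
      push_cast
      linarith
    · have h1 := c.lt_one (y + y) i
      have h2 := c.nonneg y i
      have h3 : (z : ℝ) < ((1 : ℤ) : ℝ) := by push_cast; linarith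
      have h4 : z < 1 := by exact_mod_cast h3
      omega
  choose z hz hz0 using hz
  have hzsum : ∑ i, z i = 1 := by
    have h1 : ((∑ i, z i : ℤ) : ℝ) = 1 := by
      push_cast
      rw [← Finset.sum_congr rfl fun i _ => hz i, Finset.sum_sub_distrib, Finset.sum_add_distrib,
        (hlift 1 le_rfl (by omega)).sum, (hlift 2 (by omega) hk2).sum]
      norm_num
    exact_mod_cast h1
  obtain ⟨b, -, hb⟩ : ∃ b ∈ univ, 0 < z b := by
    by_contra! hcon
    have := Finset.sum_nonpos hcon
    omega
  have hzb : ∀ i, z i = if i = b then 1 else 0 := by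
    have h1 := Finset.add_sum_erase univ z (mem_univ b)
    have h2 : 0 ≤ ∑ i ∈ univ.erase b, z i := Finset.sum_nonneg fun i _ => hz0 i
    have h3 : ∑ i ∈ univ.erase b, z i = 0 := by omega
    intro i
    split_ifs with hi
    · subst hi
      omega
    · exact (Finset.sum_eq_zero_iff_of_nonneg fun i _ => hz0 i).1 h3 i
        (mem_erase.2 ⟨hi, mem_univ i⟩)
  refine ⟨b, f 1 - Pi.single b 1, fun s hs1 hs2 => ⟨s, ?_⟩⟩
  obtain ⟨t, rfl⟩ := Nat.exists_eq_add_of_le' hs1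
  ext i
  have h1 := hlin t hs2 i
  have h2 := hz i
  have h3 : (Pi.single b 1 : ι → ℝ) i = z i := by
    rw [hzb, Pi.single_apply]
    split_ifs <;> simp
  simp only [Pi.add_apply, Pi.smul_apply, Pi.sub_apply, smul_eq_mul, h3]
  push_cast
  rw [h1, ← h2]
  ring

end FracCoords

/-! ### Volume, index and barycentric coordinates of a lattice simplex. -/

namespace LatticeSimplex

open MeasureTheory

variable {d : ℕ}

/-- The volume of the standard corner simplex in `ℝ^d` is at least `1 / d!`. -/
theorem le_volume_corner (d : ℕ) : ENNReal.ofReal (1 / (d.factorial : ℝ)) ≤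
    volume {x : Fin d → ℝ | (∀ i, 0 ≤ x i) ∧ ∑ i, x i ≤ 1} := by
  set S : Set (Fin d → ℝ) := {x | (∀ i, 0 ≤ x i) ∧ ∑ i, x i ≤ 1}
  let E : (Fin d → Bool) → (Fin d → ℝ) →ₗ[ℝ] (Fin d → ℝ) := fun ε =>
    Matrix.toLin' (Matrix.diagonal fun i => if ε i then (1 : ℝ) else -1)
  have hvol : ∀ ε, volume (E ε '' S) = volume S := by
    intro ε
    rw [Measure.addHaar_image_linearMap, LinearMap.det_toLin', Matrix.det_diagonal,
      Finset.abs_prod]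
    have : ∀ i, |if ε i then (1 : ℝ) else -1| = 1 := by
      intro i
      split_ifs <;> simp
    simp [this]
  -- The `2 ^ d` sign changes of the corner cover the cross-polytope, of volume `2 ^ d / d!`.
  have hcover : {x : Fin d → ℝ | ∑ i, |x i| ^ (1 : ℝ) < 1} ⊆ ⋃ ε, E ε '' S := by
    intro x hx
    simp only [Real.rpow_one] at hx
    refine Set.mem_iUnion.2 ⟨fun i => decide (0 ≤ x i), fun i => |x i|,
      ⟨fun i => abs_nonneg _, le_of_lt hx⟩, ?_⟩
    ext i
    simp only [E, Matrix.toLin'_apply, Matrix.mulVec_diagonal, decide_eq_true_eq]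
    split_ifs with h
    · rw [abs_of_nonneg h, one_mul]
    · rw [abs_of_neg (not_le.1 h)]
      ring
  have h1 := (measure_mono hcover).trans (measure_iUnion_fintype_le volume _)
  rw [volume_sum_rpow_lt_one (Fin d) le_rfl, Finset.sum_congr rfl fun ε _ => hvol ε] at h1
  simp only [Finset.sum_const, Finset.card_univ, Fintype.card_fun, Fintype.card_bool,
    Fintype.card_fin, nsmul_eq_mul, div_one, Real.Gamma_nat_eq_factorial,
    one_add_one_eq_two, Real.Gamma_two, mul_one] at h1
  have h2 : ENNReal.ofReal (2 ^ d / (d.factorial : ℝ)) =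
      ((2 ^ d : ℕ) : ENNReal) * ENNReal.ofReal (1 / (d.factorial : ℝ)) := by
    rw [div_eq_mul_one_div, ENNReal.ofReal_mul (by positivity)]
    congr 1
    rw [← ENNReal.ofReal_natCast]
    norm_num
  rw [h2] at h1
  exact (ENNReal.mul_le_mul_iff_right (by simp) (by finiteness)).1 h1

/-- The inclusion of the integer vectors into the real vectors. -/
def castVec (d : ℕ) : (Fin d → ℤ) →+ (Fin d → ℝ) :=
  (Int.castAddHom ℝ).compLeft (Fin d)

theorem castVec_apply (x : Fin d → ℤ) (r : Fin d) : castVec d x r = x r := rfl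

theorem castVec_injective : Function.Injective (castVec d) := fun x y h => by
  ext r
  have := congrFun h r
  simpa [castVec_apply] using this

/-- The matrix whose columns are the edge vectors from vertex `0`. -/
def edgeMatrix (V : Fin (d + 1) → Fin d → ℤ) : Matrix (Fin d) (Fin d) ℤ :=
  Matrix.of fun r j => V j.succ r - V 0 r

theorem castVec_edgeMatrix (V : Fin (d + 1) → Fin d → ℤ) (n : Fin d → ℤ) :
    castVec d ((edgeMatrix V).mulVec n) =
      ∑ j, (n j : ℝ) • (castVec d (V j.succ) - castVec d (V 0)) := by
  ext r
  simp only [castVec_apply, Matrix.mulVec, dotProduct, edgeMatrix, Matrix.of_apply, Finset.sum_apply,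
    Pi.smul_apply, Pi.sub_apply, smul_eq_mul]
  push_cast
  exact Finset.sum_congr rfl fun j _ => mul_comm _ _

section Basis

variable (b : AffineBasis (Fin (d + 1)) ℝ (Fin d → ℝ))

theorem linear_coord_sub (i j k : Fin (d + 1)) :
    (b.coord i).linear (b j - b k) = (if i = j then 1 else 0) - (if i = k then 1 else 0) := by
  have := (b.coord i).linearMap_vsub (b j) (b k)
  rw [vsub_eq_sub, vsub_eq_sub] at this
  rw [this, b.coord_apply, b.coord_apply]

theorem coord_add (i j : Fin (d + 1)) (v : Fin d → ℝ) :
    b.coord i (v + b j) = (b.coord i).linear v + if i = j then 1 else 0 := by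
  have := (b.coord i).map_vadd (b j) v
  rw [vadd_eq_add, vadd_eq_add] at this
  rw [this, b.coord_apply]

theorem sum_linear_coord (v : Fin d → ℝ) : ∑ i, (b.coord i).linear v = 0 := by
  have h := b.sum_coord_apply_eq_one (v + b 0)
  simp only [coord_add, Finset.sum_add_distrib, Finset.sum_ite_eq', Finset.mem_univ,
    if_true] at h
  linarith

theorem sum_linear_coord_smul (v : Fin d → ℝ) :
    ∑ j : Fin d, (b.coord j.succ).linear v • (b j.succ - b 0) = v := by
  have h := b.linear_combination_coord_eq_self (v + b 0)
  have h0 := sum_linear_coord b v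
  rw [Fin.sum_univ_succ] at h h0
  simp only [coord_add, if_true, Fin.succ_ne_zero, if_false, add_zero] at h
  simp only [smul_sub, Finset.sum_sub_distrib, ← Finset.sum_smul]
  rw [← eq_neg_iff_add_eq_zero] at h0
  rw [h0, add_smul, one_smul, neg_smul] at h
  rw [← add_right_cancel_iff (a := b 0), ← h]
  abel

variable {V : Fin (d + 1) → Fin d → ℤ} (hV : ∀ i, castVec d (V i) = b i)
include hV

theorem linear_coord_edgeMatrix (i : Fin (d + 1)) (n : Fin d → ℤ) :
    ∃ z : ℤ, (b.coord i).linear (castVec d ((edgeMatrix V).mulVec n)) = z := by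
  refine ⟨∑ j, n j * ((if i = j.succ then 1 else 0) - (if i = 0 then 1 else 0)), ?_⟩
  simp only [castVec_edgeMatrix, map_sum, map_smul, hV, linear_coord_sub, smul_eq_mul]
  push_cast
  rfl

theorem mulVec_edgeMatrix_injective : Function.Injective (edgeMatrix V).mulVec := by
  intro m n hmn
  have h : ∀ (n : Fin d → ℤ) (j : Fin d),
      (b.coord j.succ).linear (castVec d ((edgeMatrix V).mulVec n)) = n j := by
    intro n j
    simp only [castVec_edgeMatrix, map_sum, map_smul, hV, linear_coord_sub, smul_eq_mul,
      Fin.succ_inj, Fin.succ_ne_zero, if_false, sub_zero, mul_ite, mul_one, mul_zero,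
      Finset.sum_ite_eq, Finset.mem_univ, if_true]
  ext j
  have h1 := h m j
  have h2 := h n j
  rw [hmn, h2] at h1
  exact_mod_cast h1.symm

theorem det_edgeMatrix_ne_zero : (edgeMatrix V).det ≠ 0 := by
  intro h
  obtain ⟨v, hv, hv0⟩ := Matrix.exists_mulVec_eq_zero_iff.2 h
  exact hv (mulVec_edgeMatrix_injective b hV (by rw [hv0, Matrix.mulVec_zero]))

theorem card_quotient_edgeMatrix :
    Nat.card ((Fin d → ℤ) ⧸ (edgeMatrix V).mulVecLin.range) = (edgeMatrix V).det.natAbs := by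
  rw [← Submodule.natAbs_det_equiv _
    (LinearEquiv.ofInjective (edgeMatrix V).mulVecLin (mulVec_edgeMatrix_injective b hV))]
  rw [← LinearMap.det_toLin']
  rfl

/-- The barycentric coordinates modulo `ℤ` on the quotient of the integer lattice by the lattice
spanned by the edges of the simplex. -/
theorem exists_fracCoords :
    ∃ c : FracCoords ((Fin d → ℤ) ⧸ (edgeMatrix V).mulVecLin.range) (Fin (d + 1)),
      ∀ x i, c.coord (Submodule.Quotient.mk x) i =
        Int.fract ((b.coord i).linear (castVec d x)) := by
  set L := (edgeMatrix V).mulVecLin.range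
  have hwd : ∀ x y : Fin d → ℤ, (Submodule.Quotient.mk x : (Fin d → ℤ) ⧸ L) =
      Submodule.Quotient.mk y → ∀ i, Int.fract ((b.coord i).linear (castVec d x)) =
        Int.fract ((b.coord i).linear (castVec d y)) := by
    intro x y hxy i
    obtain ⟨n, hn⟩ := (Submodule.Quotient.eq L).1 hxy
    obtain ⟨z, hz⟩ := linear_coord_edgeMatrix b hV i n
    have hn' : (edgeMatrix V).mulVec n = x - y := hn
    rw [hn', map_sub, map_sub] at hz
    exact Int.fract_eq_fract.2 ⟨z, hz⟩
  refine ⟨⟨fun g i => Int.fract ((b.coord i).linear (castVec d (Quotient.out g))),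
    fun g i => Int.fract_nonneg _, fun g i => Int.fract_lt_one _, ?_, ?_⟩, ?_⟩
  · intro g h i
    have h1 := hwd (Quotient.out (g + h)) (Quotient.out g + Quotient.out h) (by
      rw [Submodule.Quotient.mk_add, Submodule.Quotient.mk_out, Submodule.Quotient.mk_out,
        Submodule.Quotient.mk_out]) i
    rw [h1, map_add, map_add]
    obtain ⟨z, hz⟩ := Int.fract_add ((b.coord i).linear (castVec d (Quotient.out g)))
      ((b.coord i).linear (castVec d (Quotient.out h)))
    exact ⟨z, by linarith⟩
  · intro g hg
    choose z hz using fun i => Int.fract_eq_zero_iff.1 (hg i)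
    have h1 : castVec d ((edgeMatrix V).mulVec fun j => z j.succ) =
        castVec d (Quotient.out g) := by
      rw [castVec_edgeMatrix, ← sum_linear_coord_smul b (castVec d (Quotient.out g))]
      refine Finset.sum_congr rfl fun j _ => ?_
      rw [hz, hV, hV]
    rw [← Submodule.Quotient.mk_out g, Submodule.Quotient.mk_eq_zero]
    exact ⟨_, castVec_injective h1⟩
  · intro x i
    exact hwd _ _ (Submodule.Quotient.mk_out _) i

/-- The volume of a lattice simplex is at least `|det| / d!`. -/
theorem le_volume_convexHull : ENNReal.ofReal ((edgeMatrix V).det.natAbs / (d.factorial : ℝ)) ≤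
    volume (convexHull ℝ (Set.range b)) := by
  set M : (Fin d → ℝ) →ₗ[ℝ] (Fin d → ℝ) :=
    Matrix.toLin' ((edgeMatrix V).map (Int.castRingHom ℝ)) with hM
  have hdet : |LinearMap.det M| = (edgeMatrix V).det.natAbs := by
    rw [hM, LinearMap.det_toLin', ← RingHom.mapMatrix_apply, ← RingHom.map_det,
      Nat.cast_natAbs, Int.cast_abs]
    rfl
  set S : Set (Fin d → ℝ) := {x | (∀ i, 0 ≤ x i) ∧ ∑ i, x i ≤ 1}
  have hsub : (fun v => b 0 + v) '' (M '' S) ⊆ convexHull ℝ (Set.range b) := by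
    rintro _ ⟨_, ⟨x, ⟨hx0, hx1⟩, rfl⟩, rfl⟩
    have hMx : M x = ∑ j, x j • (b j.succ - b 0) := by
      ext r
      simp only [hM, Matrix.toLin'_apply, Matrix.mulVec, dotProduct, Matrix.map_apply, edgeMatrix,
        Matrix.of_apply, Finset.sum_apply, Pi.smul_apply, Pi.sub_apply, smul_eq_mul, ← hV,
        castVec_apply]
      refine Finset.sum_congr rfl fun j _ => ?_
      simp [mul_comm]
    have h1 : b 0 + M x = ∑ i, (Fin.cons (1 - ∑ j, x j) x : Fin (d + 1) → ℝ) i • b i := by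
      rw [Fin.sum_univ_succ, hMx]
      simp only [Fin.cons_zero, Fin.cons_succ, smul_sub, Finset.sum_sub_distrib, ← Finset.sum_smul,
        sub_smul, one_smul]
      abel
    show b 0 + M x ∈ _
    rw [h1]
    refine (convex_convexHull ℝ _).sum_mem (fun i _ => ?_) ?_
      fun i _ => subset_convexHull ℝ _ (Set.mem_range_self i)
    · refine Fin.cases ?_ (fun j => ?_) i
      · simpa using hx1
      · simpa using hx0 j
    · rw [Fin.sum_univ_succ]
      simp
  refine le_trans ?_ (measure_mono hsub)
  rw [Set.image_add_left, measure_preimage_add, Measure.addHaar_image_linearMap, hdet,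
    div_eq_mul_one_div, ENNReal.ofReal_mul (by positivity)]
  exact mul_le_mul_right (le_volume_corner d) _

end Basis

end LatticeSimplex

/-! ### The theorem on interior lattice points. -/

/-- In a clean `k`-point lattice `d`-simplex of minimal volume with `d ≥ 3`, any two distinct
interior lattice points are collinear with a vertex, and all the interior lattice points together
are collinear with one vertex. -/
theorem mainTheorem3 (d k : ℕ) (hd : 3 ≤ d) (T : Affine.Simplex ℝ (Fin d → ℝ) d)
    (hT : IsCleanLatticeSimplex k T)
    (hvol : MeasureTheory.volume (simplexBody T) =
      ENNReal.ofReal (((d : ℝ) * (k : ℝ) + 1) / (d.factorial : ℝ))) :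
    (∀ w₁ ∈ interiorLatticePoints T, ∀ w₂ ∈ interiorLatticePoints T, w₁ ≠ w₂ →
      ∃ i : Fin (d + 1), Collinear ℝ {w₁, w₂, T.points i}) ∧
    (∃ i : Fin (d + 1), Collinear ℝ (insert (T.points i) (interiorLatticePoints T))) := by
  classical
  suffices h : ∃ i : Fin (d + 1),
      Collinear ℝ (insert (T.points i) (interiorLatticePoints T)) by
    refine ⟨fun w₁ h₁ w₂ h₂ _ => ?_, h⟩
    obtain ⟨i, hi⟩ := h
    refine ⟨i, hi.subset ?_⟩
    rintro x (rfl | rfl | rfl)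
    · exact Set.mem_insert_of_mem _ h₁
    · exact Set.mem_insert_of_mem _ h₂
    · exact Set.mem_insert _ _
  let b : AffineBasis (Fin (d + 1)) ℝ (Fin d → ℝ) := ⟨T.points, T.independent,
    T.independent.affineSpan_eq_top_iff_card_eq_finrank_add_one.2 (by simp)⟩
  have hlat : ∀ x ∈ intLattice d, ∃ z : Fin d → ℤ, LatticeSimplex.castVec d z = x := by
    intro x hx
    choose z hz using hx
    exact ⟨z, funext fun i => (hz i).symm⟩
  choose V hV using fun i => hlat (b i) (hT.lattice (Set.mem_range_self i))
  set L := (LatticeSimplex.edgeMatrix V).mulVecLin.range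
  obtain ⟨c, hc⟩ := LatticeSimplex.exists_fracCoords b hV
  have hcardL : Nat.card ((Fin d → ℤ) ⧸ L) = (LatticeSimplex.edgeMatrix V).det.natAbs :=
    LatticeSimplex.card_quotient_edgeMatrix b hV
  have hfin : Finite ((Fin d → ℤ) ⧸ L) := Nat.finite_of_card_ne_zero (by
    rw [hcardL]
    exact Int.natAbs_ne_zero.2 (LatticeSimplex.det_edgeMatrix_ne_zero b hV))
  have := Fintype.ofFinite ((Fin d → ℤ) ⧸ L)
  have hGcard : Fintype.card ((Fin d → ℤ) ⧸ L) ≤ d * k + 1 := by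
    have h1 : ENNReal.ofReal ((LatticeSimplex.edgeMatrix V).det.natAbs / (d.factorial : ℝ)) ≤
        ENNReal.ofReal (((d : ℝ) * (k : ℝ) + 1) / (d.factorial : ℝ)) :=
      (LatticeSimplex.le_volume_convexHull b hV).trans_eq hvol
    rw [ENNReal.ofReal_le_ofReal_iff (by positivity),
      div_le_div_iff_of_pos_right (by positivity), ← hcardL, Nat.card_eq_fintype_card] at h1
    exact_mod_cast h1
  have hcoord : ∀ p ∈ interiorLatticePoints T, ∃ g : (Fin d → ℤ) ⧸ L,
      (∀ i, 0 < b.coord i p) ∧ ∀ i, c.coord g i = b.coord i p := by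
    intro p hp
    have hpos : ∀ i, 0 < b.coord i p := by
      have h1 : p ∈ interior (convexHull ℝ (Set.range b)) := hp.1
      rw [b.interior_convexHull] at h1
      exact h1
    obtain ⟨x, hx⟩ := hlat p hp.2
    -- Translating by vertex `0` changes each coordinate by an integer, and those of an interior
    -- point already lie in `(0, 1)`.
    refine ⟨Submodule.Quotient.mk (x - V 0), hpos, fun i => ?_⟩
    have h2 := LatticeSimplex.coord_add b i 0 (p - b 0)
    rw [sub_add_cancel] at h2
    have hlt : b.coord i p < 1 := by
      have : Nontrivial (Fin (d + 1)) := Fin.nontrivial_iff_two_le.2 (by omega)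
      obtain ⟨j, hj⟩ := exists_ne i
      rw [← b.sum_coord_apply_eq_one p]
      exact Finset.single_lt_sum hj (Finset.mem_univ i) (Finset.mem_univ j) (hpos j)
        fun l _ _ => (hpos l).le
    rw [hc, map_sub, hx, hV, Int.fract_eq_iff]
    refine ⟨(hpos i).le, hlt, -(if i = 0 then 1 else 0), ?_⟩
    rw [h2]
    push_cast
    ring
  choose! g hgpos hgcoord using hcoord
  have hSfin : (interiorLatticePoints T).Finite := by
    refine Set.finite_of_encard_eq_coe hT.card_interior
  have hginj : Set.InjOn g (interiorLatticePoints T) := by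
    intro p hp q hq hpq
    rw [← b.linear_combination_coord_eq_self p, ← b.linear_combination_coord_eq_self q]
    refine Finset.sum_congr rfl fun i _ => ?_
    rw [← hgcoord p hp, ← hgcoord q hq, hpq]
  have hAcard : (hSfin.toFinset.image g).card = k := by
    rw [Finset.card_image_of_injOn (by simpa using hginj)]
    have h1 := hT.card_interior
    rw [hSfin.encard_eq_coe_toFinset_card] at h1
    exact_mod_cast h1
  have hA : ∀ a ∈ hSfin.toFinset.image g, ∃ p ∈ interiorLatticePoints T, g p = a := by
    intro a ha
    obtain ⟨p, hp, rfl⟩ := Finset.mem_image.1 ha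
    exact ⟨p, hSfin.mem_toFinset.1 hp, rfl⟩
  obtain ⟨i, u, hu⟩ := FracCoords.exists_line (c := c) (A := hSfin.toFinset.image g) hd (by simp)
    (by
      intro a ha i
      obtain ⟨p, hp, rfl⟩ := hA a ha
      rw [hgcoord p hp]
      exact hgpos p hp i)
    (by
      intro a ha
      obtain ⟨p, hp, rfl⟩ := hA a ha
      rw [Finset.sum_congr rfl fun i _ => hgcoord p hp i]
      exact b.sum_coord_apply_eq_one p)
    (by rw [hAcard]; exact hGcard)
  refine ⟨i, (collinear_iff_of_mem (Set.mem_insert _ _)).2 ⟨∑ j, u j • b j, ?_⟩⟩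
  rintro p (rfl | hp)
  · exact ⟨0, by simp⟩
  · obtain ⟨s, hs⟩ := hu (g p) (Finset.mem_image_of_mem g (hSfin.mem_toFinset.2 hp))
    refine ⟨s, ?_⟩
    have h1 : ∀ j, b.coord j p = (Pi.single i 1 : Fin (d + 1) → ℝ) j + s * u j := fun j => by
      rw [← hgcoord p hp, hs]
      rfl
    rw [← b.linear_combination_coord_eq_self p]
    simp only [h1, add_smul, Finset.sum_add_distrib, mul_smul, ← Finset.smul_sum]
    rw [vadd_eq_add, add_comm]
    congr 1
    simp only [Pi.single_apply, ite_smul, one_smul, zero_smul, Finset.sum_ite_eq', Finset.mem_univ,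
      if_true]
    rfl
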